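/- \textbf{Definitions.} An \emph{M-category} is a category $\mathcal C$ in which each hom-set $\mathcal C(A,B)$ is equipped with a complete ultrametric $d$ with $d\le 1$, such that composition is non-expansive: $d(g\cdot f,\,g'\cdot f')\le\max\{d(f,f'),d(g,g')\}$. It is \emph{stable} if $d(f,g)=\sup_{i\in I}d(h_i\cdot f,h_i\cdot g)$ for all $f,g\colon A\to B$ and every non-empty (small) jointly monic family $h_i\colon B\to C_i$ $(i\in I)$. $\mathcal C$ has \emph{limits of chains} if it has limits of all $\alpha^{\mathrm{op}}$-indexed diagrams for every ordinal $\alpha>0$. In that case, if $\mathcal C$ has a terminal object $1$, the \emph{final sequence} of an endofunctor $H$ is the diagram $D\colon\mathbf{Ord}^{\mathrm{op}}\to\mathcal C$, unique up to isomorphism, with $D_0=1$, $D_{\alpha+1}=HD_\alpha$, $D_{\alpha+1,\beta+1}=HD_{\alpha,\beta}$ for $\beta\le\alpha$, and $D_\alpha=\lim_{\beta<\alpha}D_\beta$ (with projections $D_{\alpha,\beta}$) for limit ordinals $\alpha$; it \emph{converges} if $D_{\alpha+1,\alpha}$ is an isomorphism for some $\alpha$. For a bifunctor $B\colon\mathcal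 C^{\mathrm{op}}\times\mathcal C\to\mathcal C$, a \emph{higher-order coalgebra} is a pair $(Z,z)$ with $z\colon Z\to B(Z,Z)$; a morphism $(Z,z)\to(W,w)$ is $h\colon Z\to W$ with $B(\mathrm{id},h)\cdot z=B(h,\mathrm{id})\cdot w\cdot h$. It is \emph{locally final} if $(Z,z)$ is a final coalgebra for the endofunctor $B(Z,-)$. \textbf{Theorem (Existence of locally final coalgebras).} Let $\mathcal C$ be a stable M-category with a terminal object $1$ and limits of chains, and let $B\colon\mathcal C^{\mathrm{op}}\times\mathcal C\to\mathcal C$ be a bifunctor such that (1) $B$ is locally contractive in the first argument, i.e. there is $c\in[0,1)$ with $d(B(f,Y),B(g,Y))\le c\cdot d(f,g)$ for all $f,g\colon X\to X'$ and all $Y$, and locally non-expansive in the second argument, i.e. $d(B(X,f),B(X,g))\le d(f,g)$ for all $f,g\colon Y\to Y'$ and all $X$; (2) the hom-set $\mathcal C(1,B(1,1))$ is inhabited; (3) for each object $X$, the final sequence of the endofunctor $B(X,-)$ converges. Then final coalgebras $\tau_X\colon FX\to B(X,FX)$ of the endofunctors $B(X,-)$ exist for all $X$ and form a functor $F\colon\mathcal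 C^{\mathrm{op}}\to\mathcal C$, $FX=\nu B(X,-)$, where for $f\colon X\to Y$ the morphism $Ff\colon FY\to FX$ is the $B(X,-)$-coalgebra morphism from $(FY,B(f,\mathrm{id})\cdot\tau_Y)$ to $(FX,\tau_X)$; and $B$ has a locally final coalgebra $(Z,z)$ that is a fixed point of $F$, i.e. there is an isomorphism $i\colon Z\cong FZ$ with $z=B(\mathrm{id},i^{-1})\cdot\tau_Z\cdot i$. If all hom-sets of $\mathcal C$ are inhabited, then the locally final coalgebra of $B$ is unique up to isomorphism of higher-order coalgebras. -/

import Mathlib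

open CategoryTheory CategoryTheory.Limits Opposite

universe w v u

/-- An M-category: every hom-set is a complete, 1-bounded ultrametric space, and composition is
non-expansive with respect to the maximum metric on the product of hom-sets. -/
class MCategory (C : Type u) [Category.{v} C] where
  homMetric (X Y : C) : MetricSpace (X ⟶ Y)
  dist_le_one {X Y : C} (f g : X ⟶ Y) : dist f g ≤ 1
  dist_le_max {X Y : C} (f g h : X ⟶ Y) : dist f h ≤ max (dist f g) (dist g h)
  complete (X Y : C) : CompleteSpace (X ⟶ Y)
  dist_comp_le {X Y Z : C} (f f' : X ⟶ Y) (g g' : Y ⟶ Z) :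
    dist (f ≫ g) (f' ≫ g') ≤ max (dist f f') (dist g g')

attribute [reducible, instance] MCategory.homMetric

namespace MCategory

variable {C : Type u} [Category.{v} C]

/-- A family of morphisms with common domain `B` is jointly monic if it separates all parallel
pairs of morphisms into `B`. -/
def JointlyMonic {I : Type w} {B : C} {Y : I → C} (h : ∀ i, B ⟶ Y i) : Prop :=
  ∀ ⦃A : C⦄ (f g : A ⟶ B), (∀ i, f ≫ h i = g ≫ h i) → f = g

variable (C) in
/-- An M-category is stable if distances of morphisms are computed as suprema along any inhabited
(small) jointly monic family. -/
def IsStable [MCategory C] : Prop :=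
  ∀ ⦃A B : C⦄ (f g : A ⟶ B) (I : Type w) [Nonempty I] (Y : I → C) (h : ∀ i, B ⟶ Y i),
    JointlyMonic h → IsLUB (Set.range fun i => dist (f ≫ h i) (g ≫ h i)) (dist f g)

variable [MCategory C]

/-- All functors `B(-, Y)` are contractive on hom-sets, with one contraction factor `c < 1` that
does not depend on the objects. -/
def LocallyContractiveFst (B : Cᵒᵖ ⥤ C ⥤ C) : Prop :=
  ∃ c : ℝ, 0 ≤ c ∧ c < 1 ∧ ∀ ⦃X X' : C⦄ (Y : C) (f g : X ⟶ X'),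
    dist ((B.map f.op).app Y) ((B.map g.op).app Y) ≤ c * dist f g

/-- All functors `B(X, -)` are non-expansive on hom-sets. -/
def LocallyNonexpansiveSnd (B : Cᵒᵖ ⥤ C ⥤ C) : Prop :=
  ∀ (X : C) ⦃Y Y' : C⦄ (f g : Y ⟶ Y'),
    dist ((B.obj (op X)).map f) ((B.obj (op X)).map g) ≤ dist f g

end MCategory

section FinalSequence

variable {C : Type u} [Category.{v} C]

variable (C) in
/-- Limits of `αᵒᵖ`-chains for all ordinals `α > 0`, where `α` is viewed as the poset of all
ordinals below `α`. -/
def HasLimitsOfChains : Prop :=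
  ∀ α : Ordinal.{w}, 0 < α → HasLimitsOfShape (Set.Iio α)ᵒᵖ C

/-- The restriction of a diagram `D : Ordᵒᵖ ⥤ C` to the ordinals below `α`. -/
def ordRestrict (D : Ordinal.{w}ᵒᵖ ⥤ C) (α : Ordinal.{w}) : (Set.Iio α)ᵒᵖ ⥤ C :=
  (Monotone.functor (f := fun β : Set.Iio α => β.1) fun _ _ h => h).op ⋙ D

/-- The cone over `(D β)_{β < α}` with vertex `D α` given by the connecting morphisms. -/
def ordCone (D : Ordinal.{w}ᵒᵖ ⥤ C) (α : Ordinal.{w}) : Cone (ordRestrict D α) where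
  pt := D.obj (op α)
  π :=
    { app := fun β => D.map (homOfLE (le_of_lt β.unop.2)).op
      naturality := by
        intro β γ f
        simp only [ordRestrict, Functor.const_obj_obj, Functor.const_obj_map, Category.id_comp,
          Functor.comp_map]
        rw [← D.map_comp]
        rfl }

/-- The final sequence of an endofunctor `H`: the diagram `D : Ordᵒᵖ ⥤ C` that starts in the
terminal object, is given by `H` at successor ordinals (objects and connecting morphisms) and by
limits at limit ordinals. These conditions determine `D` up to isomorphism. -/
structure FinalSequence (H : C ⥤ C) where
  D : Ordinal.{w}ᵒᵖ ⥤ C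
  isTerminalZero : IsTerminal (D.obj (op 0))
  succIso (α : Ordinal.{w}) : D.obj (op (Order.succ α)) ≅ H.obj (D.obj (op α))
  map_succ {α β : Ordinal.{w}} (h : β ≤ α) :
    D.map (homOfLE (Order.succ_le_succ h)).op ≫ (succIso β).hom =
      (succIso α).hom ≫ H.map (D.map (homOfLE h).op)
  isLimit (α : Ordinal.{w}) (hα : Order.IsSuccLimit α) : IsLimit (ordCone D α)

/-- The final sequence of `H` converges if the connecting morphism `D_{α+1} ⟶ D_α` is an
isomorphism for some `α`. -/
def FinalSequenceConverges (H : C ⥤ C) : Prop :=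
  ∃ (S : FinalSequence.{w} H) (α : Ordinal.{w}),
    IsIso (S.D.map (homOfLE (Order.le_succ α)).op)

end FinalSequence

section HigherOrder

variable {C : Type u} [Category.{v} C]

/-- A higher-order coalgebra `Z ⟶ B(Z, Z)` for a bifunctor `B`. -/
structure HigherOrderCoalgebra (B : Cᵒᵖ ⥤ C ⥤ C) where
  carrier : C
  str : carrier ⟶ (B.obj (op carrier)).obj carrier

namespace HigherOrderCoalgebra

variable {B : Cᵒᵖ ⥤ C ⥤ C}

/-- A morphism of higher-order coalgebras `(Z, z) ⟶ (W, w)` is a morphism `h : Z ⟶ W` with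
`B(Z, h) ∘ z = B(h, W) ∘ w ∘ h`, as morphisms `Z ⟶ B(Z, W)`. -/
@[ext]
structure Hom (Z W : HigherOrderCoalgebra B) where
  hom : Z.carrier ⟶ W.carrier
  comm : Z.str ≫ (B.obj (op Z.carrier)).map hom = hom ≫ W.str ≫ (B.map hom.op).app W.carrier

instance : Category (HigherOrderCoalgebra B) where
  Hom := Hom
  id Z := ⟨𝟙 _, by simp⟩
  comp {Z W V} f g := ⟨f.hom ≫ g.hom, by
    have hf := f.comm
    have hg := g.comm
    calc Z.str ≫ (B.obj (op Z.carrier)).map (f.hom ≫ g.hom)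
        = (Z.str ≫ (B.obj (op Z.carrier)).map f.hom) ≫ (B.obj (op Z.carrier)).map g.hom := by simp
      _ = f.hom ≫ (W.str ≫ (B.obj (op W.carrier)).map g.hom) ≫
            (B.map f.hom.op).app V.carrier := by
          rw [hf]; simp
      _ = (f.hom ≫ g.hom) ≫ V.str ≫ (B.map (f.hom ≫ g.hom).op).app V.carrier := by
          rw [hg]; simp⟩
  id_comp _ := Hom.ext (Category.id_comp _)
  comp_id _ := Hom.ext (Category.comp_id _)
  assoc _ _ _ := Hom.ext (Category.assoc _ _ _)

/-- A higher-order coalgebra `Z ⟶ B(Z, Z)` is locally final if it is a final coalgebra for the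
endofunctor `B(Z, -)`. -/
def IsLocallyFinal (Z : HigherOrderCoalgebra B) : Prop :=
  Nonempty (IsTerminal
    ({ V := Z.carrier, str := Z.str } : Endofunctor.Coalgebra (B.obj (op Z.carrier))))

end HigherOrderCoalgebra

/-- A functor `X ↦ νB(X, -)`: every `F X` carries a final coalgebra `τ X` for `B(X, -)`, and for
`f : X ⟶ Y` the morphism `F f : F Y ⟶ F X` is the (unique) `B(X, -)`-coalgebra morphism from
`(F Y, B(f, F Y) ∘ τ Y)` to `(F X, τ X)`. -/
structure FinalCoalgebraFunctor (B : Cᵒᵖ ⥤ C ⥤ C) where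
  F : Cᵒᵖ ⥤ C
  τ (X : C) : F.obj (op X) ⟶ (B.obj (op X)).obj (F.obj (op X))
  isTerminal (X : C) : IsTerminal
    ({ V := F.obj (op X), str := τ X } : Endofunctor.Coalgebra (B.obj (op X)))
  map_comm {X Y : C} (f : X ⟶ Y) :
    τ Y ≫ (B.map f.op).app (F.obj (op Y)) ≫ (B.obj (op X)).map (F.map f.op) =
      F.map f.op ≫ τ X

/-- `(Z, z)` is obtained from a fixed point of `N = νB(-, -)`: there is an isomorphism
`i : Z ≅ N Z` along which `z` is the structure of the final coalgebra `N Z`. -/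
def FinalCoalgebraFunctor.IsFixedPoint {B : Cᵒᵖ ⥤ C ⥤ C} (N : FinalCoalgebraFunctor B)
    (Z : HigherOrderCoalgebra B) : Prop :=
  ∃ i : Z.carrier ≅ N.F.obj (op Z.carrier),
    Z.str = i.hom ≫ N.τ Z.carrier ≫ (B.obj (op Z.carrier)).map i.inv

end HigherOrder

/-!
Write `F X = νB(X, -)`. The final sequence of `B(X, -)` converges, so its stationary object carries
a final coalgebra: a coalgebra `A ⟶ B(X, A)` has a unique cone over the final sequence that is
compatible with its structure (`FinalSequence.exists_compatible`,
`FinalSequence.Compatible.unique`), and coalgebra morphisms into the stationary object correspond to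
such cones (`FinalSequence.nonempty_isTerminal_coalgebra`).

The functor `F` is locally contractive with the contraction factor `c` of `B`: finality alone does
not give this, because `B(X, -)` is merely non-expansive. Instead `d(F f, F g) ≤ c * d(f, g)` is
proved for all projections to the final sequence of `B(X, -)` by transfinite induction, where
contractivity of `B` in the first argument gives the successor steps and stability the limit steps
(`MCategory.dist_finalCoalgebraFunctor_map_le`).

A locally contractive contravariant functor `F` with a morphism `1 ⟶ F 1` has a fixed point. The
iterates `1, F 1, F (F 1), …` are linked by embedding-projection pairs, which get `c`-times closer
to isomorphisms in each step. By stability the limit `Z` of the projections is approximated by its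
stages, `d(π n ≫ ε n, 𝟙) ≤ c ^ n` (`EmbeddingProjection.exists_limit`), and mutually inverse
morphisms between `Z` and `F Z` are the limits of the Cauchy sequences `π (n + 1) ≫ F (π n)` and
`F (ε n) ≫ ε (n + 1)` (`MCategory.exists_iso_of_locallyContractive`). The hypothesis on
`1 ⟶ B(1, 1)` provides the morphism `1 ⟶ F 1`, and a fixed point of `F` is the same thing as a
locally final coalgebra.

For uniqueness, fixed points `i : Z ≅ F Z` and `k : W ≅ F W` give maps between the hom-sets `Z ⟶ W`
and `W ⟶ Z` that are contractive, so Banach's theorem yields `f : Z ⟶ W` and `g : W ⟶ Z` with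
`f ≫ k = i ≫ F g` and `g ≫ i = k ≫ F f`. The composites `f ≫ g` and `g ≫ f` are fixed points of
contractions that also fix the identities, hence `f` and `g` are mutually inverse
(`MCategory.exists_iso_of_fixedPoints`), and they are morphisms of higher-order coalgebras
(`FinalCoalgebraFunctor.comm_of_fixedPoint`).
-/

/-! ### Final coalgebras from the final sequence -/

namespace FinalSequence

variable {C : Type u} [Category.{v} C] {H : C ⥤ C} (S : FinalSequence.{w} H)

/-- The connecting morphism `D α ⟶ D β` of the final sequence for `β ≤ α`. -/
abbrev proj {α β : Ordinal.{w}} (h : β ≤ α) : S.D.obj (op α) ⟶ S.D.obj (op β) :=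
  S.D.map (homOfLE h).op

@[simp]
lemma proj_self (α : Ordinal.{w}) : S.proj (le_refl α) = 𝟙 _ := S.D.map_id _

lemma proj_comp {α β γ : Ordinal.{w}} (h : β ≤ α) (h' : γ ≤ β) :
    S.proj h ≫ S.proj h' = S.proj (h'.trans h) := (S.D.map_comp _ _).symm

lemma proj_comp_assoc {α β γ : Ordinal.{w}} (h : β ≤ α) (h' : γ ≤ β) {A : C}
    (f : S.D.obj (op γ) ⟶ A) : S.proj h ≫ S.proj h' ≫ f = S.proj (h'.trans h) ≫ f := by
  rw [← Category.assoc, proj_comp]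

lemma hom_ext_zero {A : C} {α : Ordinal.{w}} (hα : α = 0) (f g : A ⟶ S.D.obj (op α)) :
    f = g := by
  subst hα
  exact S.isTerminalZero.hom_ext f g

lemma hom_ext_limit {A : C} {α : Ordinal.{w}} (hα : Order.IsSuccLimit α)
    {f g : A ⟶ S.D.obj (op α)}
    (h : ∀ β (hβ : β < α), f ≫ S.proj hβ.le = g ≫ S.proj hβ.le) : f = g :=
  (S.isLimit α hα).hom_ext fun β => h β.unop.1 β.unop.2

/-- A morphism `f : A ⟶ D α` out of the carrier of a coalgebra `a : A ⟶ H A` is compatible if its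
components `f_β : A ⟶ D β` satisfy the recursion `f_{β+1} = H f_β ∘ a` that determines the
canonical cone of the coalgebra over the final sequence. -/
def Compatible {A : C} (a : A ⟶ H.obj A) {α : Ordinal.{w}} (f : A ⟶ S.D.obj (op α)) : Prop :=
  ∀ β (hβ : β < α), f ≫ S.proj (Order.succ_le_of_lt hβ) ≫ (S.succIso β).hom =
    a ≫ H.map (f ≫ S.proj hβ.le)

variable {S}

lemma Compatible.comp_proj {A : C} {a : A ⟶ H.obj A} {α β : Ordinal.{w}}
    {f : A ⟶ S.D.obj (op α)} (hf : S.Compatible a f) (h : β ≤ α) :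
    S.Compatible a (f ≫ S.proj h) := by
  intro γ hγ
  have := hf γ (hγ.trans_le h)
  simpa only [Category.assoc, proj_comp, proj_comp_assoc] using this

lemma Compatible.unique {A : C} {a : A ⟶ H.obj A} {α : Ordinal.{w}}
    {f g : A ⟶ S.D.obj (op α)} (hf : S.Compatible a f) (hg : S.Compatible a g) : f = g := by
  have key : ∀ β (h : β ≤ α), f ≫ S.proj h = g ≫ S.proj h := by
    intro β
    induction β using SuccOrder.limitRecOn with
    | isMin b hb => exact fun h => S.hom_ext_zero hb.eq_bot _ _
    | succ b _ ih =>
      intro h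
      have hb := Order.succ_le_iff.1 h
      rw [← cancel_mono (S.succIso b).hom, Category.assoc, Category.assoc, hf b hb, hg b hb,
        ih hb.le]
    | isSuccLimit b hb ih =>
      intro h
      refine S.hom_ext_limit hb fun β hβ => ?_
      simp only [Category.assoc, proj_comp]
      exact ih β hβ _
  simpa using key α le_rfl

variable (S)

lemma exists_compatible {A : C} (a : A ⟶ H.obj A) (α : Ordinal.{w}) :
    ∃ f : A ⟶ S.D.obj (op α), S.Compatible a f := by
  induction α using SuccOrder.limitRecOn with
  | isMin b hb =>
    obtain rfl : b = 0 := hb.eq_bot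
    exact ⟨S.isTerminalZero.from A, fun β hβ => absurd hβ (not_lt_bot (a := β))⟩
  | succ b _ ih =>
    obtain ⟨f, hf⟩ := ih
    have hsucc : ∀ β (h : β ≤ b), (a ≫ H.map f ≫ (S.succIso b).inv) ≫
        S.proj (Order.succ_le_succ h) ≫ (S.succIso β).hom = a ≫ H.map (f ≫ S.proj h) := by
      intro β h
      simp [S.map_succ h]
    have hle : ∀ β (h : β ≤ b), (a ≫ H.map f ≫ (S.succIso b).inv) ≫
        S.proj (h.trans (Order.le_succ b)) = f ≫ S.proj h := by
      intro β
      induction β using SuccOrder.limitRecOn with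
      | isMin c hc => exact fun h => S.hom_ext_zero hc.eq_bot _ _
      | succ c _ _ =>
        intro h
        have hc := Order.succ_le_iff.1 h
        rw [← cancel_mono (S.succIso c).hom, Category.assoc, Category.assoc f, hf c hc,
          ← hsucc c hc.le]
      | isSuccLimit c hc ih =>
        intro h
        refine S.hom_ext_limit hc fun β hβ => ?_
        rw [Category.assoc, proj_comp, Category.assoc f, proj_comp]
        exact ih β hβ _
    refine ⟨a ≫ H.map f ≫ (S.succIso b).inv, fun β hβ => ?_⟩
    have h := Order.lt_succ_iff.1 hβ
    rw [hle β h, hsucc β h]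
  | isSuccLimit b hb ih =>
    choose f hf using ih
    let s : Cone (ordRestrict S.D b) :=
      { pt := A
        π :=
          { app := fun β => f β.unop.1 β.unop.2
            naturality := by
              intro β γ φ
              have h : γ.unop.1 ≤ β.unop.1 := leOfHom φ.unop
              exact (Category.id_comp _).trans
                ((hf _ γ.unop.2).unique ((hf _ β.unop.2).comp_proj h)) } }
    obtain ⟨g, hs⟩ : ∃ g : A ⟶ S.D.obj (op b), ∀ β (hβ : β < b), g ≫ S.proj hβ.le = f β hβ :=
      ⟨(S.isLimit b hb).lift s, fun β hβ => (S.isLimit b hb).fac s (op ⟨β, hβ⟩)⟩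
    refine ⟨g, fun β hβ => ?_⟩
    rw [hs β hβ, ← Category.assoc, hs _ (hb.succ_lt hβ)]
    have h := hf _ (hb.succ_lt hβ) β (Order.lt_succ β)
    rw [proj_self, Category.id_comp] at h
    rw [h, (hf _ (hb.succ_lt hβ)).comp_proj (Order.le_succ β) |>.unique (hf β hβ)]

/-- If the connecting morphism `D (α + 1) ⟶ D α` is invertible, its inverse turns `D α` into a
coalgebra. -/
noncomputable abbrev coalgebra (α : Ordinal.{w}) [IsIso (S.proj (Order.le_succ α))] :
    Endofunctor.Coalgebra H where
  V := S.D.obj (op α)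
  str := inv (S.proj (Order.le_succ α)) ≫ (S.succIso α).hom

lemma coalgebra_str_map_proj {α β : Ordinal.{w}} [IsIso (S.proj (Order.le_succ α))]
    (h : β < α) :
    (S.coalgebra α).str ≫ H.map (S.proj h.le) =
      S.proj (Order.succ_le_of_lt h) ≫ (S.succIso β).hom := by
  rw [Category.assoc, ← S.map_succ h.le, IsIso.inv_comp_eq, proj_comp_assoc]

lemma coalgebra_hom_proj {α β : Ordinal.{w}} [IsIso (S.proj (Order.le_succ α))]
    {V : Endofunctor.Coalgebra H} (φ : V ⟶ S.coalgebra α) (h : β < α) :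
    φ.f ≫ S.proj (Order.succ_le_of_lt h) ≫ (S.succIso β).hom =
      V.str ≫ H.map (φ.f ≫ S.proj h.le) := by
  rw [← S.coalgebra_str_map_proj h, H.map_comp, ← Category.assoc φ.f,
    ← Category.assoc V.str, φ.h]

/-- Coalgebra morphisms into `D α` are exactly the compatible morphisms, so there is exactly one
from every coalgebra. -/
theorem nonempty_isTerminal_coalgebra (α : Ordinal.{w}) [IsIso (S.proj (Order.le_succ α))] :
    Nonempty (IsTerminal (S.coalgebra α)) := by
  have hex : ∀ V : Endofunctor.Coalgebra H, Nonempty (V ⟶ S.coalgebra α) := by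
    intro V
    obtain ⟨f, hf⟩ := S.exists_compatible V.str (Order.succ α)
    refine ⟨⟨f ≫ S.proj (Order.le_succ α), ?_⟩⟩
    have h := hf α (Order.lt_succ α)
    rw [proj_self, Category.id_comp] at h
    rw [← h, Category.assoc, IsIso.hom_inv_id_assoc]
  refine ⟨IsTerminal.ofUniqueHom (fun V => (hex V).some) fun V m => ?_⟩
  ext
  exact Compatible.unique (fun β hβ => S.coalgebra_hom_proj m hβ)
    (fun β hβ => S.coalgebra_hom_proj _ hβ)

end FinalSequence

theorem FinalSequenceConverges.exists_isTerminal {C : Type u} [Category.{v} C] {H : C ⥤ C}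
    (h : FinalSequenceConverges.{w} H) :
    ∃ V : Endofunctor.Coalgebra H, Nonempty (IsTerminal V) := by
  obtain ⟨S, α, _⟩ := h
  exact ⟨_, S.nonempty_isTerminal_coalgebra α⟩

namespace FinalCoalgebraFunctor

variable {C : Type u} [Category.{v} C] {B : Cᵒᵖ ⥤ C ⥤ C}

/-- For `f : X ⟶ Y`, postcomposition with `B(f, -)` turns `B(Y, -)`-coalgebras into
`B(X, -)`-coalgebras. -/
abbrev pullback (B : Cᵒᵖ ⥤ C ⥤ C) {X Y : C} (f : X ⟶ Y)
    (V : Endofunctor.Coalgebra (B.obj (op Y))) : Endofunctor.Coalgebra (B.obj (op X)) :=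
  ⟨V.V, V.str ≫ (B.map f.op).app V.V⟩

lemma pullback_comp_comm {X Y Z : Cᵒᵖ} (g : Z ⟶ Y) (f : Y ⟶ X)
    {VX : Endofunctor.Coalgebra (B.obj X)} {VY : Endofunctor.Coalgebra (B.obj Y)}
    {VZ : Endofunctor.Coalgebra (B.obj Z)} {u : VY.V ⟶ VX.V} {t : VZ.V ⟶ VY.V}
    (hu : (VY.str ≫ (B.map f).app VY.V) ≫ (B.obj X).map u = u ≫ VX.str)
    (ht : (VZ.str ≫ (B.map g).app VZ.V) ≫ (B.obj Y).map t = t ≫ VY.str) :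
    (VZ.str ≫ (B.map (g ≫ f)).app VZ.V) ≫ (B.obj X).map (t ≫ u) = (t ≫ u) ≫ VX.str := by
  rw [Category.assoc t, ← hu, ← Category.assoc t, ← Category.assoc t, ← ht]
  simp

/-- The functor structure on a choice of final coalgebras for all the functors `B(X, -)`. -/
noncomputable def ofIsTerminal (V : ∀ X : C, Endofunctor.Coalgebra (B.obj (op X)))
    (t : ∀ X, IsTerminal (V X)) : FinalCoalgebraFunctor B where
  F :=
    { obj := fun X => (V X.unop).V
      map := fun {Y X} f => ((t X.unop).from (pullback B f.unop (V Y.unop))).f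
      map_id := fun X => by
        have := (t X.unop).hom_ext ((t X.unop).from (pullback B (𝟙 X.unop) (V X.unop)))
          ⟨𝟙 _, by simp⟩
        exact congrArg (·.f) this
      map_comp := fun {Z Y X} g f => by
        have hf := ((t X.unop).from (pullback B f.unop (V Y.unop))).h
        have hg := ((t Y.unop).from (pullback B g.unop (V Z.unop))).h
        have := (t X.unop).hom_ext
          ((t X.unop).from (pullback B (f.unop ≫ g.unop) (V Z.unop)))
          ⟨((t Y.unop).from (pullback B g.unop (V Z.unop))).f ≫
            ((t X.unop).from (pullback B f.unop (V Y.unop))).f,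
            pullback_comp_comm g f hf hg⟩
        exact congrArg (·.f) this }
  τ X := (V X).str
  isTerminal X := t X
  map_comm {X Y} f := by
    simpa using ((t X).from (pullback B f (V Y))).h

end FinalCoalgebraFunctor

/-! ### Metric estimates in M-categories -/

namespace MCategory

variable {C : Type u} [Category.{v} C] [MCategory C]

lemma dist_comp_left_le {X Y Z : C} (f : X ⟶ Y) (g g' : Y ⟶ Z) :
    dist (f ≫ g) (f ≫ g') ≤ dist g g' :=
  (dist_comp_le f f g g').trans (by simp)

lemma dist_comp_right_le {X Y Z : C} (f f' : X ⟶ Y) (g : Y ⟶ Z) :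
    dist (f ≫ g) (f' ≫ g) ≤ dist f f' :=
  (dist_comp_le f f' g g).trans (by simp)

lemma dist_comp_isIso {X Y Z : C} (f f' : X ⟶ Y) (g : Y ⟶ Z) [IsIso g] :
    dist (f ≫ g) (f' ≫ g) = dist f f' := by
  refine le_antisymm (dist_comp_right_le f f' g) ?_
  simpa using dist_comp_right_le (f ≫ g) (f' ≫ g) (inv g)

lemma tendsto_comp {X Y Z : C} {f : ℕ → (X ⟶ Y)} {g : ℕ → (Y ⟶ Z)} {f₀ : X ⟶ Y} {g₀ : Y ⟶ Z}
    (hf : Filter.Tendsto f Filter.atTop (nhds f₀)) (hg : Filter.Tendsto g Filter.atTop (nhds g₀)) :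
    Filter.Tendsto (fun n => f n ≫ g n) Filter.atTop (nhds (f₀ ≫ g₀)) := by
  rw [tendsto_iff_dist_tendsto_zero] at hf hg ⊢
  refine squeeze_zero (fun _ => dist_nonneg) (fun n => dist_comp_le _ _ _ _) ?_
  simpa using hf.max hg

lemma tendsto_of_dist_le_pow {X Y : C} {c : ℝ} (hc₀ : 0 ≤ c) (hc₁ : c < 1)
    {f : ℕ → (X ⟶ Y)} {f₀ : X ⟶ Y} (h : ∀ n, dist (f n) f₀ ≤ c ^ n) :
    Filter.Tendsto f Filter.atTop (nhds f₀) :=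
  tendsto_iff_dist_tendsto_zero.2
    (squeeze_zero (fun _ => dist_nonneg) h (tendsto_pow_atTop_nhds_zero_of_lt_one hc₀ hc₁))

lemma exists_tendsto_of_dist_le_pow {X Y : C} {c : ℝ} (hc₁ : c < 1)
    {f : ℕ → (X ⟶ Y)} (h : ∀ n, dist (f n) (f (n + 1)) ≤ c ^ n) :
    ∃ f₀, Filter.Tendsto f Filter.atTop (nhds f₀) :=
  have := MCategory.complete X Y
  cauchySeq_tendsto_of_complete
    (cauchySeq_of_le_geometric c 1 hc₁ fun n => (h n).trans (one_mul (c ^ n)).ge)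

/-- Distances of morphisms into `D α` can be bounded by transfinite induction along the final
sequence: stability takes care of the limit steps. -/
lemma dist_le_of_finalSequence (hC : IsStable.{w} C) {H : C ⥤ C} (S : FinalSequence.{w} H)
    {A : C} {α : Ordinal.{w}} (u v : A ⟶ S.D.obj (op α)) {r : ℝ} (hr : 0 ≤ r)
    (hsucc : ∀ β (h : β < α), dist (u ≫ S.proj h.le) (v ≫ S.proj h.le) ≤ r →
      dist (u ≫ S.proj (Order.succ_le_of_lt h)) (v ≫ S.proj (Order.succ_le_of_lt h)) ≤ r) :
    dist u v ≤ r := by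
  have key : ∀ β (h : β ≤ α), dist (u ≫ S.proj h) (v ≫ S.proj h) ≤ r := by
    intro β
    induction β using SuccOrder.limitRecOn with
    | isMin b hb =>
      intro h
      rwa [S.hom_ext_zero hb.eq_bot (u ≫ S.proj h) (v ≫ S.proj h), dist_self]
    | succ b _ ih => exact fun h => hsucc b (Order.succ_le_iff.1 h) (ih _)
    | isSuccLimit b hb ih =>
      intro h
      -- Stability only speaks of families indexed by `Type w`, while `Set.Iio b` lives one level up.
      let e := (equivShrink.{w} (Set.Iio b)).symm
      have : Nonempty (Shrink.{w} (Set.Iio b)) := ⟨e.symm ⟨⊥, hb.bot_lt⟩⟩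
      have hmono : JointlyMonic fun i : Shrink.{w} (Set.Iio b) => S.proj (le_of_lt (e i).2) := by
        intro A f g hfg
        refine S.hom_ext_limit hb fun β hβ => ?_
        obtain ⟨i, hi⟩ := e.surjective ⟨β, hβ⟩
        have := hfg i
        dsimp only at this
        rwa [hi] at this
      refine (hC (u ≫ S.proj h) (v ≫ S.proj h) _ _ _ hmono).2 ?_
      rintro _ ⟨i, rfl⟩
      simp only [Category.assoc, FinalSequence.proj_comp]
      exact ih _ (e i).2 _
  simpa using key α le_rfl

/-- The functor `νB(-, -)` inherits the contraction factor of `B` in its first argument. -/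
theorem dist_finalCoalgebraFunctor_map_le (hC : IsStable.{w} C) {B : Cᵒᵖ ⥤ C ⥤ C} {c : ℝ}
    (hc : 0 ≤ c)
    (hB₁ : ∀ ⦃X X' : C⦄ (Y : C) (f g : X ⟶ X'),
      dist ((B.map f.op).app Y) ((B.map g.op).app Y) ≤ c * dist f g)
    (hB₂ : LocallyNonexpansiveSnd B)
    (hconv : ∀ X : C, FinalSequenceConverges.{w} (B.obj (op X)))
    (N : FinalCoalgebraFunctor B) {X Y : C} (f g : X ⟶ Y) :
    dist (N.F.map f.op) (N.F.map g.op) ≤ c * dist f g := by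
  obtain ⟨S, α, _⟩ := hconv X
  obtain ⟨t⟩ := S.nonempty_isTerminal_coalgebra α
  let φ := (N.isTerminal X).uniqueUpToIso t
  have : IsIso φ.hom.f := ((Endofunctor.Coalgebra.forget _).mapIso φ).isIso_hom
  have hrec : ∀ (k : X ⟶ Y) β (h : β < α),
      ((N.F.map k.op ≫ φ.hom.f) ≫ S.proj (Order.succ_le_of_lt h)) ≫ (S.succIso β).hom =
        N.τ Y ≫ (B.map k.op).app _ ≫
          (B.obj (op X)).map ((N.F.map k.op ≫ φ.hom.f) ≫ S.proj h.le) := by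
    intro k β h
    rw [Category.assoc, Category.assoc, S.coalgebra_hom_proj φ.hom h, ← Category.assoc,
      ← N.map_comm k]
    simp
  have hr : 0 ≤ c * dist f g := mul_nonneg hc dist_nonneg
  rw [← dist_comp_isIso _ _ φ.hom.f]
  refine dist_le_of_finalSequence hC S _ _ hr fun β h hβ => ?_
  rw [← dist_comp_isIso _ _ (S.succIso β).hom, hrec f β h, hrec g β h]
  refine (dist_comp_left_le _ _ _).trans ((dist_comp_le _ _ _ _).trans (max_le ?_ ?_))
  · exact hB₁ _ f g
  · exact (hB₂ X _ _).trans hβ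

end MCategory

/-! ### Limits of sequences of embedding-projection pairs -/

lemma HasLimitsOfChains.hasLimitsOfShape_nat {C : Type u} [Category.{v} C]
    (h : HasLimitsOfChains.{w} C) : HasLimitsOfShape ℕᵒᵖ C := by
  let f : ℕ → Set.Iio Ordinal.omega0.{w} := fun n => ⟨n, Ordinal.natCast_lt_omega0 n⟩
  have hf : StrictMono f := fun m n hmn => Subtype.mk_lt_mk.2 (Nat.cast_lt.2 hmn)
  have hs : Function.Surjective f := fun ⟨o, ho⟩ => by
    obtain ⟨n, rfl⟩ := Ordinal.lt_omega0.1 ho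
    exact ⟨n, rfl⟩
  have := h _ Ordinal.omega0_pos
  exact hasLimitsOfShape_of_equivalence (hf.orderIsoOfSurjective f hs).equivalence.symm.op

namespace EmbeddingProjection

variable {C : Type u} [Category.{v} C] {X : ℕ → C} (e : ∀ n, X n ⟶ X (n + 1))
  (p : ∀ n, X (n + 1) ⟶ X n)

/-- The composite of embeddings `X n ⟶ X m`. -/
abbrev up {n m : ℕ} (h : n ≤ m) : X n ⟶ X m := (Functor.ofSequence e).map (homOfLE h)

/-- The composite of projections `X m ⟶ X n`. -/
abbrev down {n m : ℕ} (h : n ≤ m) : X m ⟶ X n := (Functor.ofOpSequence p).map (homOfLE h).op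

lemma up_comp {n m k : ℕ} (h : n ≤ m) (h' : m ≤ k) : up e h ≫ up e h' = up e (h.trans h') :=
  ((Functor.ofSequence e).map_comp _ _).symm

lemma down_comp {n m k : ℕ} (h : n ≤ m) (h' : m ≤ k) :
    down p h' ≫ down p h = down p (h.trans h') :=
  ((Functor.ofOpSequence p).map_comp _ _).symm

@[simp]
lemma up_self (n : ℕ) : up e (le_refl n) = 𝟙 _ := (Functor.ofSequence e).map_id _

@[simp]
lemma down_self (n : ℕ) : down p (le_refl n) = 𝟙 _ := (Functor.ofOpSequence p).map_id _

lemma up_succ (n : ℕ) : up e n.le_succ = e n := Functor.ofSequence_map_homOfLE_succ e n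

lemma down_succ (n : ℕ) : down p n.le_succ = p n := Functor.ofOpSequence_map_homOfLE_succ p n

variable {e p}

/-- Going up and then down does not depend on the intermediate stage. -/
lemma up_comp_down_eq (hep : ∀ n, e n ≫ p n = 𝟙 _) {n m k l : ℕ} (hn : n ≤ k) (hm : m ≤ k)
    (hkl : k ≤ l) :
    up e (hn.trans hkl) ≫ down p (hm.trans hkl) = up e hn ≫ down p hm := by
  induction l, hkl using Nat.le_induction with
  | base => rfl
  | succ l hkl ih =>
    rw [← up_comp e (hn.trans hkl) l.le_succ, ← down_comp p (hm.trans hkl) l.le_succ, up_succ,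
      down_succ, Category.assoc, ← Category.assoc (e l), hep, Category.id_comp]
    exact ih

/-- The morphism `X n ⟶ X m` that goes up to stage `n + m` and back down: it is the composite of
embeddings if `n ≤ m` and the composite of projections if `m ≤ n`. -/
abbrev transfer (e : ∀ n, X n ⟶ X (n + 1)) (p : ∀ n, X (n + 1) ⟶ X n) (n m : ℕ) : X n ⟶ X m :=
  up e (Nat.le_add_right n m) ≫ down p (Nat.le_add_left m n)

lemma transfer_eq (hep : ∀ n, e n ≫ p n = 𝟙 _) {n m k : ℕ} (hn : n ≤ k) (hm : m ≤ k) :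
    transfer e p n m = up e hn ≫ down p hm :=
  (up_comp_down_eq hep _ _ (Nat.le_max_left (n + m) k)).symm.trans
    (up_comp_down_eq hep hn hm (Nat.le_max_right (n + m) k))

lemma transfer_comp_down (hep : ∀ n, e n ≫ p n = 𝟙 _) (n : ℕ) {m k : ℕ} (h : m ≤ k) :
    transfer e p n k ≫ down p h = transfer e p n m := by
  rw [Category.assoc, down_comp]
  exact (transfer_eq hep _ _).symm

lemma comp_transfer (hep : ∀ n, e n ≫ p n = 𝟙 _) (n m : ℕ) :
    e n ≫ transfer e p (n + 1) m = transfer e p n m := by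
  rw [← up_succ e n, ← Category.assoc, up_comp]
  exact (transfer_eq hep _ _).symm

lemma dist_down_comp_up_le [MCategory C] {c : ℝ} (hc₀ : 0 ≤ c) (hc₁ : c ≤ 1)
    (hpe : ∀ n, dist (p n ≫ e n) (𝟙 _) ≤ c ^ n) {n m : ℕ} (h : n ≤ m) :
    dist (down p h ≫ up e h) (𝟙 _) ≤ c ^ n := by
  induction m, h using Nat.le_induction with
  | base => simpa using pow_nonneg hc₀ n
  | succ m h ih =>
    refine (MCategory.dist_le_max _ (p m ≫ e m) _).trans (max_le ?_ ?_)
    · rw [← down_comp p h m.le_succ, ← up_comp e h m.le_succ, up_succ, down_succ, Category.assoc]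
      refine (MCategory.dist_comp_left_le _ _ _).trans ?_
      have := MCategory.dist_comp_right_le (down p h ≫ up e h) (𝟙 _) (e m)
      rw [Category.assoc, Category.id_comp] at this
      exact this.trans ih
    · exact (hpe m).trans (pow_le_pow_of_le_one hc₀ hc₁ h)

/-- If the embedding-projection pairs `(e n, p n)` converge to identities, then the limit of the
chain of projections comes with embeddings `ε n` of all stages, and it is approximated by these
stages. -/
theorem exists_limit [MCategory C] [HasLimitsOfShape ℕᵒᵖ C] (hC : MCategory.IsStable.{w} C)
    {c : ℝ} (hc₀ : 0 ≤ c) (hc₁ : c ≤ 1)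
    (hep : ∀ n, e n ≫ p n = 𝟙 _) (hpe : ∀ n, dist (p n ≫ e n) (𝟙 _) ≤ c ^ n) :
    ∃ (L : C) (π : ∀ n, L ⟶ X n) (ε : ∀ n, X n ⟶ L), (∀ n, π (n + 1) ≫ p n = π n) ∧
      (∀ n, e n ≫ ε (n + 1) = ε n) ∧ (∀ n, ε n ≫ π n = 𝟙 _) ∧
      ∀ n, dist (π n ≫ ε n) (𝟙 _) ≤ c ^ n := by
  obtain ⟨L, π, hπ, hext, hlift⟩ : ∃ (L : C) (π : ∀ n, L ⟶ X n),
      (∀ {m k : ℕ} (h : m ≤ k), π k ≫ down p h = π m) ∧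
      (∀ ⦃A : C⦄ (f g : A ⟶ L), (∀ n, f ≫ π n = g ≫ π n) → f = g) ∧
      ∀ n, ∃ f : X n ⟶ L, ∀ m, f ≫ π m = transfer e p n m := by
    let P := Functor.ofOpSequence p
    refine ⟨limit P, fun n => limit.π P (op n), fun h => limit.w P (homOfLE h).op,
      fun A f g h => limit.hom_ext fun m => h m.unop, fun n => ?_⟩
    let s : Cone P :=
      { pt := X n
        π :=
          { app := fun m => transfer e p n m.unop
            naturality := fun k m f => (Category.id_comp _).trans
              (transfer_comp_down hep n (leOfHom f.unop)).symm } }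
    exact ⟨limit.lift P s, fun m => limit.lift_π s (op m)⟩
  choose ε hε using hlift
  refine ⟨L, π, ε, fun n => ?_, fun n => hext _ _ fun m => ?_, fun n => ?_, fun n => ?_⟩
  · rw [← down_succ p n]
    exact hπ _
  · rw [Category.assoc, hε, hε, comp_transfer hep]
  · rw [hε, transfer_eq hep le_rfl le_rfl]
    simp
  · have hmono : MCategory.JointlyMonic fun i : ULift.{w} ℕ => π i.down :=
      fun A f g h => hext f g fun m => h ⟨m⟩
    refine (hC _ _ _ _ _ hmono).2 ?_
    rintro _ ⟨⟨m⟩, rfl⟩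
    dsimp only
    rw [Category.assoc, hε, Category.id_comp]
    rcases le_total m n with h | h
    · rw [transfer_eq hep le_rfl h, up_self, Category.id_comp, hπ h, dist_self]
      exact pow_nonneg hc₀ n
    · rw [transfer_eq hep h le_rfl, down_self, Category.comp_id, ← hπ h, Category.assoc]
      have := MCategory.dist_comp_left_le (π m) (down p h ≫ up e h) (𝟙 _)
      rw [Category.comp_id] at this
      exact this.trans (dist_down_comp_up_le hc₀ hc₁ hpe h)

end EmbeddingProjection

/-! ### Fixed points of locally contractive contravariant functors -/

namespace MCategory

variable {C : Type u} [Category.{v} C] (F : Cᵒᵖ ⥤ C)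

/-- The iterates `1, F 1, F (F 1), …` of a contravariant functor. -/
noncomputable def iterateObj [HasTerminal C] : ℕ → C
  | 0 => ⊤_ C
  | n + 1 => F.obj (op (iterateObj n))

/-- The embeddings and projections between consecutive iterates, starting from a morphism
`1 ⟶ F 1`. Since `F` is contravariant, it exchanges embeddings and projections. -/
noncomputable def iteratePair [HasTerminal C] (x : ⊤_ C ⟶ F.obj (op (⊤_ C))) : ∀ n,
    (iterateObj F n ⟶ iterateObj F (n + 1)) × (iterateObj F (n + 1) ⟶ iterateObj F n)
  | 0 => (x, terminal.from _)
  | n + 1 => (F.map (iteratePair x n).2.op, F.map (iteratePair x n).1.op)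

variable [MCategory C] {F} {c : ℝ}

/-- A locally contractive contravariant functor `F` has an object `Z ≅ F Z` as soon as there is a
morphism `1 ⟶ F 1`. -/
theorem exists_iso_of_locallyContractive [HasTerminal C] [HasLimitsOfShape ℕᵒᵖ C]
    (hC : IsStable.{w} C) (hc₀ : 0 ≤ c) (hc₁ : c < 1)
    (hF : ∀ ⦃X Y : C⦄ (f g : X ⟶ Y), dist (F.map f.op) (F.map g.op) ≤ c * dist f g)
    (x : ⊤_ C ⟶ F.obj (op (⊤_ C))) : ∃ Z : C, Nonempty (Z ≅ F.obj (op Z)) := by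
  let X := iterateObj F
  let e : ∀ n, X n ⟶ X (n + 1) := fun n => (iteratePair F x n).1
  let p : ∀ n, X (n + 1) ⟶ X n := fun n => (iteratePair F x n).2
  have he : ∀ n, e (n + 1) = F.map (p n).op := fun n => rfl
  have hp : ∀ n, p (n + 1) = F.map (e n).op := fun n => rfl
  have hep : ∀ n, e n ≫ p n = 𝟙 _ := by
    intro n
    induction n with
    | zero => exact terminalIsTerminal.hom_ext _ _
    | succ n ih =>
      refine (F.map_comp (p n).op (e n).op).symm.trans ?_
      rw [← op_comp, ih]
      exact F.map_id _
  have hpe : ∀ n, dist (p n ≫ e n) (𝟙 _) ≤ c ^ n := by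
    intro n
    induction n with
    | zero => simpa using dist_le_one _ _
    | succ n ih =>
      have h : p (n + 1) ≫ e (n + 1) = F.map (p n ≫ e n).op := (F.map_comp (e n).op (p n).op).symm
      have h' : 𝟙 (X (n + 1 + 1)) = F.map (𝟙 (X (n + 1))).op := (F.map_id _).symm
      rw [h, h', pow_succ']
      exact (hF _ _).trans (mul_le_mul_of_nonneg_left ih hc₀)
  obtain ⟨Z, π, ε, hπ, hε, hεπ, hπε⟩ :=
    EmbeddingProjection.exists_limit hC hc₀ hc₁.le hep hpe
  let Fπ : ∀ n, X (n + 1) ⟶ F.obj (op Z) := fun n => F.map (π n).op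
  let Fε : ∀ n, F.obj (op Z) ⟶ X (n + 1) := fun n => F.map (ε n).op
  have hFπ : ∀ n, e (n + 1) ≫ Fπ (n + 1) = Fπ n := fun n => by
    refine (F.map_comp (p n).op (π (n + 1)).op).symm.trans ?_
    rw [← op_comp, hπ]
  have hFε : ∀ n, Fε (n + 1) ≫ p (n + 1) = Fε n := fun n => by
    refine (F.map_comp (ε (n + 1)).op (e n).op).symm.trans ?_
    rw [← op_comp, hε]
  have hFπε : ∀ n, Fπ n ≫ Fε n = 𝟙 _ := fun n => by
    refine (F.map_comp (π n).op (ε n).op).symm.trans ?_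
    rw [← op_comp, hεπ]
    exact F.map_id _
  have hFεπ : ∀ n, dist (Fε n ≫ Fπ n) (𝟙 _) ≤ c ^ (n + 1) := fun n => by
    have h : Fε n ≫ Fπ n = F.map (π n ≫ ε n).op := (F.map_comp (ε n).op (π n).op).symm
    rw [h, ← F.map_id, ← op_id, pow_succ']
    exact (hF _ _).trans (mul_le_mul_of_nonneg_left (hπε n) hc₀)
  have hpow : ∀ n, c ^ (n + 1) ≤ c ^ n := fun n => pow_le_pow_of_le_one hc₀ hc₁.le n.le_succ
  -- Both sequences change in step `n` only by inserting `p (n + 1) ≫ e (n + 1)`.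
  have hinsert : ∀ {A A' : C} (n : ℕ) (f : A ⟶ X (n + 1 + 1)) (g : X (n + 1 + 1) ⟶ A'),
      dist ((f ≫ p (n + 1)) ≫ e (n + 1) ≫ g) (f ≫ g) ≤ c ^ n := fun n f g => by
    have h := (dist_comp_left_le f _ _).trans
      (dist_comp_right_le (p (n + 1) ≫ e (n + 1)) (𝟙 _) g)
    rw [Category.id_comp] at h
    simpa only [Category.assoc] using (h.trans (hpe (n + 1))).trans (hpow n)
  obtain ⟨i, hi⟩ := exists_tendsto_of_dist_le_pow hc₁ (f := fun n => π (n + 1) ≫ Fπ n)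
    fun n => by
      have h := hinsert n (π (n + 1 + 1)) (Fπ (n + 1))
      rwa [hπ, hFπ] at h
  obtain ⟨j, hj⟩ := exists_tendsto_of_dist_le_pow hc₁ (f := fun n => Fε n ≫ ε (n + 1))
    fun n => by
      have h := hinsert n (Fε (n + 1)) (ε (n + 1 + 1))
      rwa [hFε, hε] at h
  refine ⟨Z, ⟨⟨i, j, tendsto_nhds_unique (tendsto_comp hi hj) ?_,
    tendsto_nhds_unique (tendsto_comp hj hi) ?_⟩⟩⟩
  · refine tendsto_of_dist_le_pow hc₀ hc₁ fun n => ?_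
    rw [Category.assoc, ← Category.assoc (Fπ n), hFπε, Category.id_comp]
    exact (hπε _).trans (hpow n)
  · refine tendsto_of_dist_le_pow hc₀ hc₁ fun n => ?_
    rw [Category.assoc, ← Category.assoc (ε (n + 1)), hεπ, Category.id_comp]
    exact (hFεπ _).trans (hpow n)

lemma eq_of_dist_le_mul {X Y : C} {f g : X ⟶ Y} (hc₁ : c < 1) (h : dist f g ≤ c * dist f g) :
    f = g := by
  by_contra hne
  have := dist_pos.2 hne
  nlinarith

/-- Any two fixed points `i : Z ≅ F Z` and `k : W ≅ F W` of a locally contractive contravariant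
functor are isomorphic, if there is a morphism between them at all: the isomorphism `f` is a fixed
point of `f ↦ i ≫ F (k ≫ F f ≫ i⁻¹) ≫ k⁻¹`. -/
theorem exists_iso_of_fixedPoints (hc₀ : 0 ≤ c) (hc₁ : c < 1)
    (hF : ∀ ⦃X Y : C⦄ (f g : X ⟶ Y), dist (F.map f.op) (F.map g.op) ≤ c * dist f g)
    {Z W : C} (i : Z ≅ F.obj (op Z)) (k : W ≅ F.obj (op W)) (f₀ : Z ⟶ W) :
    ∃ f : Z ≅ W, f.hom ≫ k.hom = i.hom ≫ F.map f.inv.op ∧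
      f.inv ≫ i.hom = k.hom ≫ F.map f.hom.op := by
  -- The two transports swap hom-sets and are contractive.
  let s : (Z ⟶ W) → (W ⟶ Z) := fun f => k.hom ≫ F.map f.op ≫ i.inv
  let t : (W ⟶ Z) → (Z ⟶ W) := fun g => i.hom ≫ F.map g.op ≫ k.inv
  have hs : ∀ f f', dist (s f) (s f') ≤ c * dist f f' := fun f f' =>
    (dist_comp_left_le _ _ _).trans ((dist_comp_right_le _ _ _).trans (hF f f'))
  have ht : ∀ g g', dist (t g) (t g') ≤ c * dist g g' := fun g g' =>
    (dist_comp_left_le _ _ _).trans ((dist_comp_right_le _ _ _).trans (hF g g'))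
  have hts : ContractingWith ⟨c, hc₀⟩ (t ∘ s) :=
    ⟨hc₁, LipschitzWith.of_dist_le_mul fun f f' => by
      refine (ht _ _).trans (mul_le_mul_of_nonneg_left ((hs f f').trans ?_) hc₀)
      exact mul_le_of_le_one_left dist_nonneg hc₁.le⟩
  have := MCategory.complete Z W
  have : Nonempty (Z ⟶ W) := ⟨f₀⟩
  obtain ⟨f, g, hfk, hgi⟩ : ∃ (f : Z ⟶ W) (g : W ⟶ Z), f ≫ k.hom = i.hom ≫ F.map g.op ∧
      g ≫ i.hom = k.hom ≫ F.map f.op := by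
    have hf : t (s (hts.fixedPoint (t ∘ s))) = hts.fixedPoint (t ∘ s) := hts.fixedPoint_isFixedPt
    refine ⟨hts.fixedPoint (t ∘ s), s (hts.fixedPoint (t ∘ s)), ?_, by simp [s]⟩
    conv_lhs => rw [← hf]
    simp [t]
  -- An endomorphism of a fixed point that commutes with its own image under `F` is the identity.
  have hid : ∀ {V : C} (l : V ≅ F.obj (op V)) (g : V ⟶ V),
      g ≫ l.hom = l.hom ≫ F.map g.op → g = 𝟙 V := by
    intro V l g hg
    refine eq_of_dist_le_mul hc₁ ?_
    calc dist g (𝟙 V) = dist (g ≫ l.hom) (𝟙 V ≫ l.hom) := (dist_comp_isIso _ _ _).symm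
      _ = dist (l.hom ≫ F.map g.op) (l.hom ≫ F.map (𝟙 V).op) := by simp [hg]
      _ ≤ c * dist g (𝟙 V) := (dist_comp_left_le _ _ _).trans (hF _ _)
  refine ⟨⟨f, g, hid i _ ?_, hid k _ ?_⟩, hfk, hgi⟩
  · rw [Category.assoc, hgi, ← Category.assoc, hfk, Category.assoc, ← F.map_comp, op_comp]
  · rw [Category.assoc, hfk, ← Category.assoc, hgi, Category.assoc, ← F.map_comp, op_comp]

end MCategory

/-! ### Locally final coalgebras and fixed points -/

namespace FinalCoalgebraFunctor

variable {C : Type u} [Category.{v} C] {B : Cᵒᵖ ⥤ C ⥤ C} (N : FinalCoalgebraFunctor B)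

/-- The higher-order coalgebra obtained from a fixed point `i : Z ≅ F Z` of `F = νB(-, -)`. -/
abbrev ofIso {Z : C} (i : Z ≅ N.F.obj (op Z)) : HigherOrderCoalgebra B :=
  ⟨Z, i.hom ≫ N.τ Z ≫ (B.obj (op Z)).map i.inv⟩

lemma isLocallyFinal_ofIso {Z : C} (i : Z ≅ N.F.obj (op Z)) : (N.ofIso i).IsLocallyFinal :=
  ⟨(N.isTerminal Z).ofIso (Endofunctor.Coalgebra.isoMk i.symm (by simp))⟩

lemma isFixedPoint_of_isLocallyFinal {Z : HigherOrderCoalgebra B} (h : Z.IsLocallyFinal) :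
    N.IsFixedPoint Z := by
  obtain ⟨t⟩ := h
  let φ := t.uniqueUpToIso (N.isTerminal Z.carrier)
  let i : Z.carrier ≅ N.F.obj (op Z.carrier) := (Endofunctor.Coalgebra.forget _).mapIso φ
  refine ⟨i, ?_⟩
  have h : Z.str ≫ (B.obj (op Z.carrier)).map i.hom = i.hom ≫ N.τ Z.carrier := φ.hom.h
  rw [← Category.assoc, ← h, Category.assoc, ← Functor.map_comp, i.hom_inv_id]
  simp

/-- Solutions `f, g` of `f ≫ k = i ≫ F g` and `g ≫ i = k ≫ F f` commute with the coalgebra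
structures induced by the fixed points `i` and `k`. -/
lemma comm_of_fixedPoint {Z W : HigherOrderCoalgebra B}
    {i : Z.carrier ≅ N.F.obj (op Z.carrier)} {k : W.carrier ≅ N.F.obj (op W.carrier)}
    (hi : Z.str = i.hom ≫ N.τ Z.carrier ≫ (B.obj (op Z.carrier)).map i.inv)
    (hk : W.str = k.hom ≫ N.τ W.carrier ≫ (B.obj (op W.carrier)).map k.inv)
    (f : Z.carrier ≅ W.carrier) (hf : f.hom ≫ k.hom = i.hom ≫ N.F.map f.inv.op) :
    Z.str ≫ (B.obj (op Z.carrier)).map f.hom =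
      f.hom ≫ W.str ≫ (B.map f.hom.op).app W.carrier := by
  have hf' : i.inv ≫ f.hom = N.F.map f.inv.op ≫ k.inv := by
    rw [Iso.inv_comp_eq, ← Category.assoc, ← hf]
    simp
  have hiso : N.F.map f.hom.op ≫ N.F.map f.inv.op = 𝟙 _ := by
    rw [← N.F.map_comp, ← op_comp, f.inv_hom_id, op_id, N.F.map_id]
  have hiso' : N.F.map f.inv.op ≫ N.F.map f.hom.op = 𝟙 _ := by
    rw [← N.F.map_comp, ← op_comp, f.hom_inv_id, op_id, N.F.map_id]
  -- As `F f⁻¹` is inverse to `F f`, it commutes with the final coalgebra structures too.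
  have hτ : N.τ Z.carrier ≫ (B.obj (op Z.carrier)).map (N.F.map f.inv.op) =
      N.F.map f.inv.op ≫ N.τ W.carrier ≫ (B.map f.hom.op).app _ := by
    have h := congrArg (fun q => N.F.map f.inv.op ≫ q ≫
      (B.obj (op Z.carrier)).map (N.F.map f.inv.op)) (N.map_comm f.hom)
    rw [Category.assoc, Category.assoc, Category.assoc, ← Functor.map_comp, hiso,
      CategoryTheory.Functor.map_id, Category.comp_id, ← Category.assoc _ (N.F.map f.hom.op), hiso',
      Category.id_comp] at h
    exact h.symm
  calc Z.str ≫ (B.obj (op Z.carrier)).map f.hom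
      = i.hom ≫ (N.τ Z.carrier ≫ (B.obj (op Z.carrier)).map (N.F.map f.inv.op)) ≫
          (B.obj (op Z.carrier)).map k.inv := by
        rw [hi, Category.assoc, Category.assoc, Category.assoc, ← Functor.map_comp, hf',
          Functor.map_comp]
    _ = (i.hom ≫ N.F.map f.inv.op) ≫ N.τ W.carrier ≫
          (B.obj (op W.carrier)).map k.inv ≫ (B.map f.hom.op).app W.carrier := by
        rw [hτ]
        simp
    _ = f.hom ≫ W.str ≫ (B.map f.hom.op).app W.carrier := by
        rw [← hf, hk]
        simp

end FinalCoalgebraFunctor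

theorem mainTheorem3 {C : Type u} [Category.{v} C] [MCategory C] [HasTerminal C]
    (hstable : MCategory.IsStable.{w} C) (hchains : HasLimitsOfChains.{w} C)
    (B : Cᵒᵖ ⥤ C ⥤ C)
    (hB₁ : MCategory.LocallyContractiveFst B) (hB₂ : MCategory.LocallyNonexpansiveSnd B)
    (hinh : Nonempty (⊤_ C ⟶ (B.obj (op (⊤_ C))).obj (⊤_ C)))
    (hconv : ∀ X : C, FinalSequenceConverges.{w} (B.obj (op X))) :
    (∃ (N : FinalCoalgebraFunctor B) (Z : HigherOrderCoalgebra B),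
      Z.IsLocallyFinal ∧ N.IsFixedPoint Z) ∧
    ((∀ X Y : C, Nonempty (X ⟶ Y)) →
      ∀ Z W : HigherOrderCoalgebra B, Z.IsLocallyFinal → W.IsLocallyFinal → Nonempty (Z ≅ W)) := by
  obtain ⟨c, hc₀, hc₁, hB₁⟩ := hB₁
  choose V hV using fun X => (hconv X).exists_isTerminal
  let N := FinalCoalgebraFunctor.ofIsTerminal V fun X => (hV X).some
  have hF : ∀ ⦃X Y : C⦄ (f g : X ⟶ Y), dist (N.F.map f.op) (N.F.map g.op) ≤ c * dist f g :=
    fun X Y f g => MCategory.dist_finalCoalgebraFunctor_map_le hstable hc₀ hB₁ hB₂ hconv N f g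
  refine ⟨?_, fun hne Z W hZ hW => ?_⟩
  · have := hchains.hasLimitsOfShape_nat
    obtain ⟨x⟩ := hinh
    -- The given morphism is a `B(1, -)`-coalgebra on `1`, hence induces a morphism `1 ⟶ F 1`.
    obtain ⟨Z, ⟨i⟩⟩ := MCategory.exists_iso_of_locallyContractive hstable hc₀ hc₁ hF
      ((N.isTerminal (⊤_ C)).from ⟨⊤_ C, x⟩).f
    exact ⟨N, N.ofIso i, N.isLocallyFinal_ofIso i, i, rfl⟩
  · obtain ⟨i, hi⟩ := N.isFixedPoint_of_isLocallyFinal hZ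
    obtain ⟨k, hk⟩ := N.isFixedPoint_of_isLocallyFinal hW
    obtain ⟨f, hf, hf'⟩ := MCategory.exists_iso_of_fixedPoints hc₀ hc₁ hF i k
      (hne Z.carrier W.carrier).some
    exact ⟨⟨⟨f.hom, N.comm_of_fixedPoint hi hk f hf⟩,
      ⟨f.inv, N.comm_of_fixedPoint hk hi f.symm hf'⟩,
      HigherOrderCoalgebra.Hom.ext f.hom_inv_id, HigherOrderCoalgebra.Hom.ext f.inv_hom_id⟩⟩
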